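/- **Theorem (Incompleteness).** There is a program $P$ whose target location is unreachable although the formula $\hat\varphi$ computed for it by the algorithm below is satisfiable. Moreover $P$ can be chosen such that $\hat\varphi\equiv\mathit{true}$ up to the choice of the fresh propositional variables in it: they can be given truth values for which $\hat\varphi$ holds for all inputs. *Programs.* A program is a finite connected directed graph with a start vertex $l_s$ of in-degree $0$ and a target vertex $l_t\neq l_s$ of out-degree $0$; every vertex except $l_t$ has out-degree $1$ or $2$. Edges are labelled with instructions $\mathtt{assume}(\gamma)$, $\mathtt{assert}(\gamma)$, $a\leftarrow e$ or $\mathtt{skip}$ over finitely many integer variables, with linear integer expressions $e$ and predicates $\gamma$ (possibly negated); the two out-edges of a vertex of out-degree $2$ carry $\mathtt{assume}(\gamma)$ and $\mathtt{assume}(\neg\gamma)$. (The witness needs no arrays.) For an acyclic path $\alpha v$ from $l_s$, the loop at $v$ consists of the vertices of all cycles from $v$ to $v$ whose inner vertices avoid $\alpha v$; if it is non-empty, $v$ is a loop entry. Programs are normalized: every edge into a loop entry is labelled $\mathtt{skip}$. The target is unreachable if no path from $l_s$ to $l_t$ is followed by an execution on any input. *The algorithm.* The acyclic paths from $l_s$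 to $l_t$ (backbones) are executed symbolically, starting from the state that gives each variable $a$ its input symbol $\underline a$, and a backbone is dropped as soon as its path condition is unsatisfiable; $\hat\varphi$ is the disjunction of the path conditions of the remaining backbones ($\mathit{false}$ if there are none). At a loop entry the loop is summarized: the program induced by the loop (the loop cut open at its entry) is treated recursively, which gives backbones $\pi_1,\dots,\pi_n$ with path conditions and final states; if $n=0$ the loop is skipped. Otherwise counters $\kappa_1,\dots,\kappa_n\ge 0$ are introduced and an iterated state $\theta^{\vec\kappa}$ is computed, as the fixed point of an iteration that starts with the unknown value $\star$ for every variable. The iterated value of $a$ is $\underline a+\sum_j d_j\kappa_j$ if each $\pi_j$ leaves $a$ unchanged or adds to it an expression $d_j$ free of $\underline a$ and of the counters; it is a nested conditional, choosing the value written by the backbone executed last, if each $\pi_j$ leaves $a$ unchanged or sets it to an expression $\rho_j$ free of $\underline a$ and of all counters except $\kappa_j$; in all other cases it is $\star$. (Values are taken after substitution of the iterated values of the other variables; for a nested loop, the sum of its counters is replaced by a linear function of $\vec\kappa$ and of the input symbols if one is found, and by $\star$ otherwise.) The state becomes $\theta^{\vec\kappa}$ composed with the state before the loop, and the path condition is extended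 by $\exists\vec\kappa\ge\vec 0$ and the looping condition $$\bigwedge_{i=1}^n\forall\tau_i\Bigl(0\le\tau_i<\kappa_i\to\exists(\tau_j)_{j\ne i}\bigl(0\le\tau_j\le\kappa_j\text{ for all } j\neq i,\ \text{and}\ pc(\pi_i)\,\theta^{\vec\kappa}[\vec\kappa/\vec\tau]\bigr)\Bigr).$$ A term that contains $\star$ is unknown, and each occurrence of a predicate one of whose arguments contains $\star$ stands for a fresh propositional variable. -/

import Mathlib

namespace SymExec

/-! ## Programs over integer variables -/

/-- Linear integer program expressions over the program variables `a = 0, 1, 2, …`. -/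
inductive AExp where
  | const (n : ℤ)
  | var (a : ℕ)
  | add (e₁ e₂ : AExp)
  | sub (e₁ e₂ : AExp)
  | smul (c : ℤ) (e : AExp)

/-- Predicates of linear integer arithmetic. -/
inductive Pred where
  | le (e₁ e₂ : AExp)
  | lt (e₁ e₂ : AExp)
  | eq (e₁ e₂ : AExp)

/-- Boolean expressions of instructions: a predicate or its negation. -/
inductive Cond where
  | pos (p : Pred)
  | neg (p : Pred)

inductive Instr where
  | assume (γ : Cond)
  | assert (γ : Cond)
  | assign (a : ℕ) (e : AExp)
  | skip

def AExp.eval (σ : ℕ → ℤ) : AExp → ℤ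
  | .const n => n
  | .var a => σ a
  | .add e₁ e₂ => e₁.eval σ + e₂.eval σ
  | .sub e₁ e₂ => e₁.eval σ - e₂.eval σ
  | .smul c e => c * e.eval σ

def Pred.Holds (σ : ℕ → ℤ) : Pred → Prop
  | .le e₁ e₂ => e₁.eval σ ≤ e₂.eval σ
  | .lt e₁ e₂ => e₁.eval σ < e₂.eval σ
  | .eq e₁ e₂ => e₁.eval σ = e₂.eval σ

def Cond.Holds (σ : ℕ → ℤ) : Cond → Prop
  | .pos p => p.Holds σ
  | .neg p => ¬ p.Holds σ

def AExp.vars : AExp → Finset ℕ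
  | .const _ => ∅
  | .var a => {a}
  | .add e₁ e₂ => e₁.vars ∪ e₂.vars
  | .sub e₁ e₂ => e₁.vars ∪ e₂.vars
  | .smul _ e => e.vars

def Pred.vars : Pred → Finset ℕ
  | .le e₁ e₂ => e₁.vars ∪ e₂.vars
  | .lt e₁ e₂ => e₁.vars ∪ e₂.vars
  | .eq e₁ e₂ => e₁.vars ∪ e₂.vars

def Cond.vars : Cond → Finset ℕ
  | .pos p => p.vars
  | .neg p => p.vars

def Instr.vars : Instr → Finset ℕ
  | .assume γ => γ.vars
  | .assert γ => γ.vars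
  | .assign a e => {a} ∪ e.vars
  | .skip => ∅

/-- One concrete execution step: `I.Exec σ σ'` says that the instruction `I`, executed in the
state `σ`, lets the execution continue, in the state `σ'`. -/
def Instr.Exec (σ σ' : ℕ → ℤ) : Instr → Prop
  | .assume γ => γ.Holds σ ∧ σ' = σ
  | .assert γ => γ.Holds σ ∧ σ' = σ
  | .assign a e => σ' = Function.update σ a (e.eval σ)
  | .skip => σ' = σ

/-- A labelled control-flow graph `(V, E, l_s, l_t, ι)` with a finite set of integer variables. -/
structure Program where
  V : Finset ℕ
  E : Finset (ℕ × ℕ)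
  start : ℕ
  target : ℕ
  instr : ℕ × ℕ → Instr
  vars : Finset ℕ

/-- Sequences of program locations. -/
abbrev Path := List ℕ

/-- The last vertex of a (non-empty) path. -/
def lst (π : Path) : ℕ := π.getLastD 0

/-- The non-empty prefixes of a path, from the shortest to the longest. -/
def prefixes (π : Path) : List Path := π.inits.filter (fun δ => !δ.isEmpty)

namespace Program

def IsPath (P : Program) (π : Path) : Prop :=
  (∀ v ∈ π, v ∈ P.V) ∧ π.IsChain (fun u v => (u, v) ∈ P.E)

/-- The conditions on the graph and on the labels in the definition of a program. -/
structure WellFormed (P : Program) : Prop where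
  start_mem : P.start ∈ P.V
  target_mem : P.target ∈ P.V
  start_ne_target : P.start ≠ P.target
  edge_mem : ∀ e ∈ P.E, e.1 ∈ P.V ∧ e.2 ∈ P.V
  connected : ∀ u ∈ P.V, ∀ v ∈ P.V, Relation.EqvGen (fun x y => (x, y) ∈ P.E) u v
  out_degree : ∀ u ∈ P.V, u ≠ P.target →
    (P.E.filter (fun e => e.1 = u)).card = 1 ∨ (P.E.filter (fun e => e.1 = u)).card = 2
  start_in : ∀ e ∈ P.E, e.2 ≠ P.start
  target_out : ∀ e ∈ P.E, e.1 ≠ P.target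
  branching : ∀ u v w, v ≠ w → (u, v) ∈ P.E → (u, w) ∈ P.E → ∃ p : Pred,
    (P.instr (u, v) = .assume (.pos p) ∧ P.instr (u, w) = .assume (.neg p)) ∨
    (P.instr (u, v) = .assume (.neg p) ∧ P.instr (u, w) = .assume (.pos p))
  vars_subset : ∀ e ∈ P.E, (P.instr e).vars ⊆ P.vars

/-- The execution of `P` that is in the state `σ` at the first vertex can follow the path. -/
def Follows (P : Program) : Path → (ℕ → ℤ) → Prop
  | u :: v :: π, σ => ∃ σ', (P.instr (u, v)).Exec σ σ' ∧ P.Follows (v :: π) σ'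
  | _, _ => True

/-- A path is feasible if the execution of `P` on some input follows it. -/
def Feasible (P : Program) (π : Path) : Prop := ∃ σ : ℕ → ℤ, P.Follows π σ

/-- The target location is reachable: there is a feasible path from `l_s` to `l_t`. -/
def TargetReachable (P : Program) : Prop :=
  ∃ π : Path, P.IsPath π ∧ π.head? = some P.start ∧ π.getLast? = some P.target ∧ P.Feasible π

/-- The backbone paths: the acyclic paths from `l_s` to `l_t`. -/
def backbones (P : Program) : Set Path :=
  {π | P.IsPath π ∧ π.Nodup ∧ π.head? = some P.start ∧ π.getLast? = some P.target}

theorem backbones_finite (P : Program) : P.backbones.Finite := by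
  refine Set.Finite.subset (s := ⋃ n ∈ Finset.range (P.V.card + 1),
    (Finset.image (fun f : Fin n → P.V => List.ofFn (fun i => (f i : ℕ))) Finset.univ : Set Path))
    ?_ ?_
  · exact Set.Finite.biUnion (Finset.finite_toSet _) (fun n _ => Finset.finite_toSet _)
  · rintro π ⟨⟨hV, -⟩, hnd, -, -⟩
    simp only [Set.mem_iUnion, Finset.coe_image, Set.mem_image, Finset.mem_range]
    refine ⟨π.length, ?_, fun i => ⟨π.get i, hV _ (List.get_mem _ _)⟩, by simp, by simp⟩
    have h := Finset.card_le_card (s := π.toFinset) (t := P.V)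
      (fun x hx => hV x (List.mem_toFinset.1 hx))
    rw [List.toFinset_card_of_nodup hnd] at h
    omega

/-- The backbone paths in a fixed order. -/
noncomputable def backboneList (P : Program) : List Path := P.backbones_finite.toFinset.toList

open Classical in
/-- The loop at the last vertex `v` of the acyclic path `αv`: the vertices of all cycles
`v v₁ ⋯ vₙ v` (`n ≥ 0`) none of whose inner vertices lies on `αv`. -/
noncomputable def loopAt (P : Program) (αv : Path) : Finset ℕ :=
  P.V.filter fun x => ∃ ρ : Path, P.IsPath (lst αv :: (ρ ++ [lst αv])) ∧
    (∀ y ∈ ρ, y ∉ αv) ∧ x ∈ lst αv :: ρ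

def IsLoopEntry (P : Program) (αv : Path) : Prop := (P.loopAt αv).Nonempty

/-- The vertices outside of a loop `C` that have an edge from `C`. -/
def exits (P : Program) (C : Finset ℕ) : Finset ℕ :=
  P.V.filter fun u => u ∉ C ∧ ∃ w ∈ C, (w, u) ∈ P.E

/-- All in-edges of loop entry vertices are labelled with `skip`. -/
def Normalized (P : Program) : Prop :=
  ∀ αv : Path, P.IsPath αv → αv.Nodup → αv.head? = some P.start → P.IsLoopEntry αv →
    ∀ u, (u, lst αv) ∈ P.E → P.instr (u, lst αv) = .skip

/-- The program induced by a loop `C` at `v`: the subgraph on `C`, started at `v`, in which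
every edge back to `v` leads to a new target vertex instead. -/
def induced (P : Program) (C : Finset ℕ) (v : ℕ) : Program where
  V := insert (C.sup id + 1) C
  E := (P.E.filter (fun e => e.1 ∈ C ∧ e.2 ∈ C)).image
    (fun e => if e.2 = v then (e.1, C.sup id + 1) else e)
  start := v
  target := C.sup id + 1
  instr := fun e => if e.2 = C.sup id + 1 then P.instr (e.1, v) else P.instr e
  vars := P.vars

end Program

/-! ## Symbolic expressions -/

/-- The path counter `κ_{α,i}` of the `i`-th backbone path of the loop at `α`. -/
structure Ctr where
  loc : Path
  idx : ℕ
deriving DecidableEq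

/-- Logical variables over the natural numbers: path counters, two parameters per path counter,
and one further parameter `s`. -/
inductive LVar where
  | kappa (c : Ctr)
  | tau (c : Ctr)
  | tau' (c : Ctr)
  | s
deriving DecidableEq

/-- Basic symbols: one for the input value of each program variable, and an artificial symbol
`s_γ` for the total number of iterations of the loop at `γ`. -/
inductive Sym where
  | prog (a : ℕ)
  | art (γ : Path)
deriving DecidableEq

inductive Ty where
  | int
  | bool

/-- Symbolic expressions of type `int` (terms) and `bool` (formulae). `star` is the unknown
value. Quantifiers range over the natural numbers; bound variables are de Bruijn indices, free
variables are named. -/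
inductive SExpr : Ty → Type where
  | bvar (k : ℕ) : SExpr .int
  | lvar (x : LVar) : SExpr .int
  | sym (s : Sym) : SExpr .int
  | star : SExpr .int
  | const (n : ℤ) : SExpr .int
  | add (t u : SExpr .int) : SExpr .int
  | sub (t u : SExpr .int) : SExpr .int
  | mul (t u : SExpr .int) : SExpr .int
  | ite (φ : SExpr .bool) (t u : SExpr .int) : SExpr .int
  | tt : SExpr .bool
  | ff : SExpr .bool
  | le (t u : SExpr .int) : SExpr .bool
  | lt (t u : SExpr .int) : SExpr .bool
  | eq (t u : SExpr .int) : SExpr .bool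
  | not (φ : SExpr .bool) : SExpr .bool
  | and (φ ψ : SExpr .bool) : SExpr .bool
  | or (φ ψ : SExpr .bool) : SExpr .bool
  | imp (φ ψ : SExpr .bool) : SExpr .bool
  | all (φ : SExpr .bool) : SExpr .bool
  | ex (φ : SExpr .bool) : SExpr .bool

abbrev Term := SExpr .int
abbrev Form := SExpr .bool

namespace SExpr

/-- Does the expression contain a named variable in `f`, a basic symbol in `g`, or, if `st`,
the unknown value? -/
def contains (f : LVar → Bool) (g : Sym → Bool) (st : Bool) : {y : Ty} → SExpr y → Bool
  | _, .bvar _ => false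
  | _, .lvar x => f x
  | _, .sym s => g s
  | _, .star => st
  | _, .const _ => false
  | _, .add t u => t.contains f g st || u.contains f g st
  | _, .sub t u => t.contains f g st || u.contains f g st
  | _, .mul t u => t.contains f g st || u.contains f g st
  | _, .ite φ t u => φ.contains f g st || t.contains f g st || u.contains f g st
  | _, .tt => false
  | _, .ff => false
  | _, .le t u => t.contains f g st || u.contains f g st
  | _, .lt t u => t.contains f g st || u.contains f g st
  | _, .eq t u => t.contains f g st || u.contains f g st
  | _, .not φ => φ.contains f g st
  | _, .and φ ψ => φ.contains f g st || ψ.contains f g st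
  | _, .or φ ψ => φ.contains f g st || ψ.contains f g st
  | _, .imp φ ψ => φ.contains f g st || ψ.contains f g st
  | _, .all φ => φ.contains f g st
  | _, .ex φ => φ.contains f g st

def hasStar {y : Ty} (e : SExpr y) : Bool :=
  e.contains (fun _ => false) (fun _ => false) true

def hasSym (s : Sym) {y : Ty} (e : SExpr y) : Bool :=
  e.contains (fun _ => false) (fun s' => s' == s) false

def hasVar (x : LVar) {y : Ty} (e : SExpr y) : Bool :=
  e.contains (fun x' => x' == x) (fun _ => false) false

/-- Simultaneous substitution for named variables and basic symbols. The substituted terms never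
have unbound de Bruijn indices, so nothing is captured. -/
def subst (f : LVar → Term) (g : Sym → Term) : {y : Ty} → SExpr y → SExpr y
  | _, .bvar k => .bvar k
  | _, .lvar x => f x
  | _, .sym s => g s
  | _, .star => .star
  | _, .const n => .const n
  | _, .add t u => .add (t.subst f g) (u.subst f g)
  | _, .sub t u => .sub (t.subst f g) (u.subst f g)
  | _, .mul t u => .mul (t.subst f g) (u.subst f g)
  | _, .ite φ t u => .ite (φ.subst f g) (t.subst f g) (u.subst f g)
  | _, .tt => .tt
  | _, .ff => .ff
  | _, .le t u => .le (t.subst f g) (u.subst f g)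
  | _, .lt t u => .lt (t.subst f g) (u.subst f g)
  | _, .eq t u => .eq (t.subst f g) (u.subst f g)
  | _, .not φ => .not (φ.subst f g)
  | _, .and φ ψ => .and (φ.subst f g) (ψ.subst f g)
  | _, .or φ ψ => .or (φ.subst f g) (ψ.subst f g)
  | _, .imp φ ψ => .imp (φ.subst f g) (ψ.subst f g)
  | _, .all φ => .all (φ.subst f g)
  | _, .ex φ => .ex (φ.subst f g)

/-- Turn the free variable `x` into the de Bruijn index `k` (counted from outside of `e`). -/
def close (x : LVar) : ℕ → {y : Ty} → SExpr y → SExpr y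
  | _, _, .bvar j => .bvar j
  | k, _, .lvar x' => if x' = x then .bvar k else .lvar x'
  | _, _, .sym s => .sym s
  | _, _, .star => .star
  | _, _, .const n => .const n
  | k, _, .add t u => .add (t.close x k) (u.close x k)
  | k, _, .sub t u => .sub (t.close x k) (u.close x k)
  | k, _, .mul t u => .mul (t.close x k) (u.close x k)
  | k, _, .ite φ t u => .ite (φ.close x k) (t.close x k) (u.close x k)
  | _, _, .tt => .tt
  | _, _, .ff => .ff
  | k, _, .le t u => .le (t.close x k) (u.close x k)
  | k, _, .lt t u => .lt (t.close x k) (u.close x k)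
  | k, _, .eq t u => .eq (t.close x k) (u.close x k)
  | k, _, .not φ => .not (φ.close x k)
  | k, _, .and φ ψ => .and (φ.close x k) (ψ.close x k)
  | k, _, .or φ ψ => .or (φ.close x k) (ψ.close x k)
  | k, _, .imp φ ψ => .imp (φ.close x k) (ψ.close x k)
  | k, _, .all φ => .all (φ.close x (k + 1))
  | k, _, .ex φ => .ex (φ.close x (k + 1))

/-- `∃ x₁ … xₙ, φ` and `∀ x₁ … xₙ, φ` for named variables `xᵢ`. -/
def exs (xs : List LVar) (φ : Form) : Form := xs.foldr (fun x ψ => .ex (ψ.close x 0)) φ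

def alls (xs : List LVar) (φ : Form) : Form := xs.foldr (fun x ψ => .all (ψ.close x 0)) φ

def conj (l : List Form) : Form := l.foldr .and .tt

def disj (l : List Form) : Form := l.foldr .or .ff

def sum : List Term → Term
  | [] => .const 0
  | [t] => t
  | t :: u :: l => .add t (sum (u :: l))

end SExpr

abbrev Ty.Val : Ty → Type
  | .int => ℤ
  | .bool => Prop

open Classical in
/-- The value of an expression, where `ν` interprets the basic symbols, `μ` the named variables
and `b` the bound variables.

A term that contains `star` is unknown, and a predicate one of whose arguments contains `star` is
a fresh propositional variable: `I` interprets these propositional variables, and an occurrence of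
such a predicate is identified by its position `p` in the whole formula. (The value given here to
a term that contains `star` is never used.) -/
noncomputable def SExpr.eval (I : List ℕ → Prop) (ν : Sym → ℤ) (μ : LVar → ℕ) :
    {y : Ty} → SExpr y → (b p : List ℕ) → y.Val
  | _, .bvar k, b, _ => ((b.getD k 0 : ℕ) : ℤ)
  | _, .lvar x, _, _ => ((μ x : ℕ) : ℤ)
  | _, .sym s, _, _ => ν s
  | _, .star, _, _ => (0 : ℤ)
  | _, .const n, _, _ => n
  | _, .add t u, b, p => ((t.eval I ν μ b (0 :: p) : ℤ) + (u.eval I ν μ b (1 :: p) : ℤ) : ℤ)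
  | _, .sub t u, b, p => ((t.eval I ν μ b (0 :: p) : ℤ) - (u.eval I ν μ b (1 :: p) : ℤ) : ℤ)
  | _, .mul t u, b, p => ((t.eval I ν μ b (0 :: p) : ℤ) * (u.eval I ν μ b (1 :: p) : ℤ) : ℤ)
  | _, .ite φ t u, b, p =>
      if (φ.eval I ν μ b (2 :: p) : Prop) then t.eval I ν μ b (0 :: p) else u.eval I ν μ b (1 :: p)
  | _, .tt, _, _ => True
  | _, .ff, _, _ => False
  | _, .le t u, b, p => if (t.hasStar || u.hasStar) = true then I p else
      ((t.eval I ν μ b (0 :: p) : ℤ) ≤ (u.eval I ν μ b (1 :: p) : ℤ) : Prop)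
  | _, .lt t u, b, p => if (t.hasStar || u.hasStar) = true then I p else
      ((t.eval I ν μ b (0 :: p) : ℤ) < (u.eval I ν μ b (1 :: p) : ℤ) : Prop)
  | _, .eq t u, b, p => if (t.hasStar || u.hasStar) = true then I p else
      ((t.eval I ν μ b (0 :: p) : ℤ) = (u.eval I ν μ b (1 :: p) : ℤ) : Prop)
  | _, .not φ, b, p => ¬ (φ.eval I ν μ b (0 :: p) : Prop)
  | _, .and φ ψ, b, p => (φ.eval I ν μ b (0 :: p) : Prop) ∧ (ψ.eval I ν μ b (1 :: p) : Prop)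
  | _, .or φ ψ, b, p => (φ.eval I ν μ b (0 :: p) : Prop) ∨ (ψ.eval I ν μ b (1 :: p) : Prop)
  | _, .imp φ ψ, b, p => (φ.eval I ν μ b (0 :: p) : Prop) → (ψ.eval I ν μ b (1 :: p) : Prop)
  | _, .all φ, b, p => ∀ n : ℕ, (φ.eval I ν μ (n :: b) (0 :: p) : Prop)
  | _, .ex φ, b, p => ∃ n : ℕ, (φ.eval I ν μ (n :: b) (0 :: p) : Prop)

/-- Truth of a formula without unbound indices under `ν`, `μ`, and an interpretation `I` of the
fresh propositional variables. -/
def Form.Holds (φ : Form) (I : List ℕ → Prop) (ν : Sym → ℤ) (μ : LVar → ℕ) : Prop :=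
  φ.eval I ν μ [] []

def Form.Satisfiable (φ : Form) : Prop := ∃ I ν μ, φ.Holds I ν μ

def Form.Valid (φ : Form) : Prop := ∀ I ν μ, φ.Holds I ν μ

/-- Equality of star-free terms: `t = u` is valid. -/
def Term.Equal (t u : Term) : Prop :=
  t.hasStar = false ∧ u.hasStar = false ∧
    ∀ I ν μ b p, (t.eval I ν μ b p : ℤ) = (u.eval I ν μ b p : ℤ)

/-! ## Symbolic states -/

abbrev State := Sym → Term

/-- The most general symbolic state `θ_G` and the most unknown one `θ_⋆`. -/
def State.general : State := fun s => .sym s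

def State.unknown : State := fun _ => .star

/-- `e θ`: substitution of a symbolic state into a symbolic expression. -/
def SExpr.applyState {y : Ty} (e : SExpr y) (θ : State) : SExpr y := e.subst .lvar θ

/-- The state `θ θ'`. -/
def State.merge (θ θ' : State) : State := fun s => (θ s).applyState θ'

/-- `θ(e)` for program expressions. -/
def AExp.symb (θ : State) : AExp → Term
  | .const n => .const n
  | .var a => θ (.prog a)
  | .add e₁ e₂ => .add (e₁.symb θ) (e₂.symb θ)
  | .sub e₁ e₂ => .sub (e₁.symb θ) (e₂.symb θ)
  | .smul c e => .mul (.const c) (e.symb θ)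

def Pred.symb (θ : State) : Pred → Form
  | .le e₁ e₂ => .le (e₁.symb θ) (e₂.symb θ)
  | .lt e₁ e₂ => .lt (e₁.symb θ) (e₂.symb θ)
  | .eq e₁ e₂ => .eq (e₁.symb θ) (e₂.symb θ)

def Cond.symb (θ : State) : Cond → Form
  | .pos p => p.symb θ
  | .neg p => .not (p.symb θ)

open Classical in
/-- Symbolic execution of an instruction in the state `θ` with the path condition `φ`. -/
noncomputable def Instr.symb (θ : State) (φ : Form) : Instr → Form × State
  | .assume γ => (if Form.Satisfiable (.imp φ (γ.symb θ)) then γ.symb θ else .ff, θ)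
  | .assert γ => (if Form.Valid (.imp φ (γ.symb θ)) then .tt else .ff, θ)
  | .assign a e => (.tt, Function.update θ (.prog a) (e.symb θ))
  | .skip => (.tt, θ)

/-! ## Path conditions -/

namespace Ctr

def kap (c : Ctr) : Term := .lvar (.kappa c)

def par (c : Ctr) : Term := .lvar (.tau c)

def par' (c : Ctr) : Term := .lvar (.tau' c)

end Ctr

/-- Substitute terms for the path counters in `cs`. -/
def SExpr.substCtrs (cs : List Ctr) (h : Ctr → Term) {y : Ty} (e : SExpr y) : SExpr y :=
  e.subst (fun x => match x with
    | .kappa c => if c ∈ cs then h c else .lvar (.kappa c)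
    | x => .lvar x) .sym

/-- The formula `u⃗ ≤ v⃗`, for vectors indexed by `cs`. -/
def vecLe (cs : List Ctr) (u v : Ctr → Term) : Form :=
  SExpr.conj (cs.map fun c => .le (u c) (v c))

/-- The formula `u⃗ < v⃗`, i.e. `u⃗ ≤ v⃗` and `∑ u⃗ < ∑ v⃗`. -/
def vecLt (cs : List Ctr) (u v : Ctr → Term) : Form :=
  .and (vecLe cs u v) (.lt (SExpr.sum (cs.map u)) (SExpr.sum (cs.map v)))

/-- The looping condition with counters `cs = (κ₁, …, κₙ)` and bodies `ψ₁, …, ψₙ`, in which the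
counters stand for the execution numbers:
`⋀ᵢ ∀ τᵢ (0 ≤ τᵢ < κᵢ → ∃ τ⃗ᵢ (0 ≤ τ⃗ᵢ ≤ κ⃗ᵢ ∧ ψᵢ[κ₁/τ₁, …, κₙ/τₙ]))`, where `τ⃗ᵢ`, `κ⃗ᵢ` omit the
`i`-th component. -/
def loopCond (cs : List Ctr) (bodies : List Form) : Form :=
  SExpr.conj ((cs.zip bodies).map fun x =>
    let others := cs.erase x.1
    SExpr.alls [.tau x.1] (.imp
      (.and (.le (.const 0) x.1.par) (.lt x.1.par x.1.kap))
      (SExpr.exs (others.map .tau)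
        (.and (.and (vecLe others (fun _ => .const 0) Ctr.par) (vecLe others Ctr.par Ctr.kap))
          (x.2.substCtrs cs Ctr.par)))))

/-- What the function `Ψ` stores at a vertex of a backbone tree: a formula, or, at a loop
entry vertex with counters, the data of a looping condition. -/
inductive Part where
  | step (φ : Form)
  | loop (cs : List Ctr) (bodies : List Form)

/-- The path condition made of the parts at the prefixes of a path. -/
def pcParts : List Part → Form
  | [] => .tt
  | .step φ :: ps => .and φ (pcParts ps)
  | .loop cs bodies :: ps => SExpr.exs (cs.map .kappa)
      (.and (vecLe cs (fun _ => .const 0) Ctr.kap) (.and (loopCond cs bodies) (pcParts ps)))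

/-! ## Symbolic execution of backbone trees -/

/-- The result of over-approximating a loop: its path counters, the bodies of its looping
condition, and its iterated symbolic state. -/
structure Summary where
  cs : List Ctr
  bodies : List Form
  state : State

open Classical in
/-- Symbolic execution along `α π`, where `α` has been processed with the parts `ps` and the
symbolic state `θ`, and `summ` over-approximates the loops of `P`. The result is `none` if the
path condition becomes unsatisfiable, so that the path is removed from the tree. -/
noncomputable def execFrom (P : Program) (summ : Path → Summary) :
    Path → Path → List Part → State → Option (List Part × State)
  | [], _, ps, θ => some (ps, θ)
  | v :: π, α, ps, θ =>
    if P.IsLoopEntry (α ++ [v]) then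
      let S := summ (α ++ [v])
      let part : Part := if S.cs = [] then .step .tt
        else .loop S.cs (S.bodies.map fun ψ => ψ.applyState θ)
      execFrom P summ π (α ++ [v]) (ps ++ [part]) (S.state.merge θ)
    else
      let r := (P.instr (lst α, v)).symb θ (pcParts ps)
      if Form.Satisfiable (pcParts (ps ++ [.step r.1])) then
        execFrom P summ π (α ++ [v]) (ps ++ [.step r.1]) r.2
      else none

/-- Symbolic execution along a path from `l_s`. -/
noncomputable def execPath (P : Program) (summ : Path → Summary) :
    Path → Option (List Part × State)
  | [] => none
  | u :: π => execFrom P summ π [u] [.step .tt] State.general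

/-- A symbolically executed backbone tree: the remaining backbone paths in a fixed order, and the
functions `Ψ` on its vertices and `Θ` on its leaves. -/
structure ExecTree where
  leaves : List Path
  Psi : Path → Part
  Theta : Path → State

namespace ExecTree

/-- The vertices of the tree: the non-empty prefixes of the remaining backbone paths. -/
def vertices (T : ExecTree) : List Path := (T.leaves.flatMap prefixes).dedup

/-- The vertices at which a loop with path counters is over-approximated. -/
def loops (T : ExecTree) : List Path :=
  T.vertices.filter fun γ => match T.Psi γ with
    | .step _ => false
    | .loop _ _ => true

/-- The path condition at a vertex. -/
def pc (T : ExecTree) (π : Path) : Form := pcParts ((prefixes π).map T.Psi)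

end ExecTree

/-- `executeBackboneTree`, applied to the backbone tree of `P`. -/
noncomputable def executeTree (P : Program) (summ : Path → Summary) : ExecTree where
  leaves := P.backboneList.filter fun π => (execPath P summ π).isSome
  Psi := fun δ => match execPath P summ δ with
    | some (ps, _) => ps.getLastD (.step .tt)
    | none => .step .ff
  Theta := fun δ => match execPath P summ δ with
    | some (_, θ) => θ
    | none => State.unknown

/-! ## Artificial symbols for nested loops -/

open Classical in
/-- Express a term through `g` instead of the counters `cs = (κ₁, …, κₘ)`, where `g` stands for
`κ₁ + ⋯ + κₘ`; the result is `star` if the term is not a function of that sum. -/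
noncomputable def absorbTerm (cs : List Ctr) (g : Term) (t : Term) : Term :=
  match cs with
  | [] => t
  | c :: cs' =>
    let h : Term → Ctr → Term := fun u d => if d = c then u else .const 0
    if Term.Equal t (t.substCtrs cs (h (SExpr.sum ((c :: cs').map Ctr.kap)))) then
      t.substCtrs cs (h g)
    else .star

/-- The same operation on all terms in a formula. -/
noncomputable def absorb (cs : List Ctr) (g : Term) : Form → Form
  | .tt => .tt
  | .ff => .ff
  | .le t u => .le (absorbTerm cs g t) (absorbTerm cs g u)
  | .lt t u => .lt (absorbTerm cs g t) (absorbTerm cs g u)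
  | .eq t u => .eq (absorbTerm cs g t) (absorbTerm cs g u)
  | .not φ => .not (absorb cs g φ)
  | .and φ ψ => .and (absorb cs g φ) (absorb cs g ψ)
  | .or φ ψ => .or (absorb cs g φ) (absorb cs g ψ)
  | .imp φ ψ => .imp (absorb cs g φ) (absorb cs g ψ)
  | .all φ => .all (absorb cs g φ)
  | .ex φ => .ex (absorb cs g φ)

/-- What the function `Ψ̄` stores at a vertex: a formula, or, at a loop entry vertex `γ`, the
body `ψ` of the weakened looping condition `∀ s (0 ≤ s < s_γ → ψ)`. -/
inductive BarPart where
  | step (φ : Form)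
  | loop (cs : List Ctr) (γ : Path) (ψ : Form)

namespace BarPart

/-- The formula `Ψ̄(γ)`. -/
def form : BarPart → Form
  | .step φ => φ
  | .loop _ γ ψ => SExpr.alls [.s] (.imp
      (.and (.le (.const 0) (.lvar .s)) (.lt (.lvar .s) (.sym (.art γ)))) ψ)

/-- The formula `Ω(γ)`, which keeps only the last iteration of a loop. -/
def omega : BarPart → Form
  | .step φ => φ
  | .loop _ γ ψ =>
      let last : Term := .sub (.sym (.art γ)) (.const 1)
      .imp (.le (.const 0) last)
        (ψ.subst (fun x => if x = .s then last else .lvar x) .sym)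

/-- The path condition made of such parts. -/
def pc : List BarPart → Form
  | [] => .tt
  | .step φ :: ps => .and φ (pc ps)
  | .loop cs γ ψ :: ps => SExpr.exs (cs.map .kappa)
      (.and (vecLe cs (fun _ => .const 0) Ctr.kap)
        (.and (BarPart.form (.loop cs γ ψ)) (pc ps)))

end BarPart

namespace ExecTree

variable (T : ExecTree)

/-- The loops, with their counters, at the vertices in a list. -/
def loopsIn (l : List Path) : List (Path × List Ctr) :=
  l.filterMap fun γ => match T.Psi γ with
    | .step _ => none
    | .loop cs _ => some (γ, cs)

/-- The function `Ψ̄`: looping conditions are weakened, and the counters of the loops above a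
vertex are expressed by the artificial symbols of these loops. -/
noncomputable def bar (δ : Path) : BarPart :=
  let up : Form → Form := fun φ =>
    (T.loopsIn (prefixes δ.dropLast)).foldl (fun ψ x => absorb x.2 (.sym (.art x.1)) ψ) φ
  match T.Psi δ with
  | .step φ => .step (up φ)
  | .loop cs bodies => .loop cs δ (up (SExpr.disj (bodies.map (absorb cs (.lvar .s)))))

/-- The function `Θ̄`. -/
noncomputable def barTheta (π : Path) : State := fun s =>
  (T.loopsIn (prefixes π)).foldl (fun t x => absorbTerm x.2 (.sym (.art x.1)) t) (T.Theta π s)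

/-- The path condition at `π` made of the parts in `Ψ̄`. -/
noncomputable def barPc (π : Path) : Form := BarPart.pc ((prefixes π).map T.bar)

end ExecTree

/-! ## Iterated values of variables -/

/-- The shapes of an iterated value `e` of a variable `a`: `a` itself, `a + ∑ dⱼ κⱼ`, the nested
conditional with the values `ρⱼ`, and `star`. Each entry belongs to the backbone path with the
given counter. -/
inductive Shape where
  | same
  | arith (l : List ((Ctr × Path) × Term))
  | flag (l : List ((Ctr × Path) × Term))
  | unknown

/-- The column of the table for values `a + d` of `a`. -/
def Shape.pushArith (x : Ctr × Path) (d : Term) : Shape → Shape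
  | .same => .arith [(x, d)]
  | .arith l => .arith (l ++ [(x, d)])
  | .flag _ => .unknown
  | .unknown => .unknown

/-- The column of the table for values `ρ` that do not depend on `a`. -/
def Shape.pushFlag (x : Ctr × Path) (ρ : Term) : Shape → Shape
  | .same => .flag [(x, ρ)]
  | .arith _ => .unknown
  | .flag l => .flag (l ++ [(x, ρ)])
  | .unknown => .unknown

open Classical in
/-- The table that combines the iterated value of `a` for the backbone paths seen so far with the
value `e'` after the backbone path `x.2` with counter `x.1`. The value `e'` is recognized as `a`;
or as `a + d`, where `d` contains neither `a` nor a counter in `cs`; or as `ρ`, which contains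
neither `a` nor a counter in `cs` other than `x.1`; all up to equality of expressions. -/
noncomputable def combine (a : ℕ) (cs : List Ctr) (e : Shape) (x : Ctr × Path) (e' : Term) :
    Shape :=
  let e₀ : Term := e'.subst .lvar (fun s => if s = .prog a then .const 0 else .sym s)
  let d : Term := e₀.substCtrs cs (fun _ => .const 0)
  let ρ : Term := e₀.substCtrs (cs.erase x.1) (fun _ => .const 0)
  if Term.Equal e' (.sym (.prog a)) then e
  else if Term.Equal e' (.add (.sym (.prog a)) d) then e.pushArith x d
  else if Term.Equal e' ρ then e.pushFlag x ρ
  else .unknown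

/-- The condition that the backbone path `x.2` is executed at least once, and as the last one of
the backbone paths in `l`; `pc` gives their path conditions. -/
def lastCond (pc : Path → Form) (l : List (Ctr × Path)) (x : Ctr × Path) : Form :=
  let cs := (l.map Prod.fst).erase x.1
  let pos : Form := .lt (.const 0) x.1.kap
  if l.length ≤ 1 then pos
  else .and pos (SExpr.exs (cs.map .tau) (.and
    (.and (vecLe cs (fun _ => .const 0) Ctr.par) (vecLe cs Ctr.par Ctr.kap))
    (.and ((pc x.2).substCtrs cs Ctr.par)
      (SExpr.alls (cs.map .tau') (.imp
        (.and (vecLt cs Ctr.par Ctr.par') (vecLe cs Ctr.par' Ctr.kap))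
        (SExpr.conj ((l.filter fun y => y.1 ≠ x.1).map fun y =>
          .not ((pc y.2).substCtrs cs Ctr.par'))))))))

def Shape.term (a : ℕ) (pc : Path → Form) : Shape → Term
  | .same => .sym (.prog a)
  | .arith l => l.foldl (fun t x => .add t (.mul x.2 x.1.1.kap)) (.sym (.prog a))
  | .flag l => l.foldr (fun x t => .ite (lastCond pc (l.map Prod.fst) x.1) x.2 t) (.sym (.prog a))
  | .unknown => .star

namespace ExecTree

variable (T : ExecTree)

/-- `iterateVariable`; `cs` lists the counters of the leaves of the tree. -/
noncomputable def iterateVariable (cs : List Ctr) (θ : State) (a : ℕ) : Term :=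
  ((cs.zip T.leaves).foldl
    (fun e x => combine a cs e x ((T.barTheta x.2 (.prog a)).applyState θ)) Shape.same).term a
    (fun π => (T.barPc π).applyState θ)

/-! ## Number of iterations of a nested loop -/

/-- The formula `Γ(γ, Ω, θ)`: some path from the loop at `γ` to one of its `exits` is taken. -/
noncomputable def exitCond (exits : Finset ℕ) (γ : Path) (θ : State) : Form :=
  SExpr.disj ((T.vertices.filter fun δ => γ.isPrefixOf δ && decide (lst δ ∈ exits)).map fun δ =>
    SExpr.conj (((prefixes δ).filter fun ε => γ.isPrefixOf ε).map fun ε =>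
      ((T.bar ε).omega).applyState θ))

end ExecTree

/-- The expression `(M κ⃗ + w)ᵀ (a⃗, 1)ᵀ`. -/
def linTerm (as : List ℕ) (cs : List Ctr) (M : Option ℕ → Ctr → ℤ) (w : Option ℕ → ℤ) : Term :=
  let coeff : Option ℕ → Term := fun o =>
    .add (SExpr.sum (cs.map fun c => .mul (.const (M o c)) c.kap)) (.const (w o))
  .add (SExpr.sum (as.map fun a => .mul (coeff (some a)) (.sym (.prog a)))) (coeff none)

/-- `linTerm` with the coefficients `M`, `w` gives the number of iterations of the loop at `γ`,
provided that `G` holds. -/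
def IsLinearCount (G : Form) (γ : Path) (as : List ℕ) (cs : List Ctr)
    (M : Option ℕ → Ctr → ℤ) (w : Option ℕ → ℤ) : Prop :=
  ∃ I : List ℕ → Prop, ∀ ν μ, 0 ≤ ν (.art γ) → Form.Holds G I ν μ →
    ν (.art γ) = max 0 (((linTerm as cs M w).eval I ν μ [] [] : ℤ))

open Classical in
/-- The number of iterations of the loop at `γ` as a linear function of the counters, or `star`;
`G` is the formula `Γ(γ, Ω, θ)`. -/
noncomputable def iterationsOfLoop (vars : Finset ℕ) (cs : List Ctr) (G : Form) (γ : Path) : Term :=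
  let as := vars.toList.filter fun a => G.hasSym (.prog a)
  let cs' := cs.filter fun c => G.hasVar (.kappa c)
  if h : ∃ Mw : (Option ℕ → Ctr → ℤ) × (Option ℕ → ℤ), IsLinearCount G γ as cs' Mw.1 Mw.2 then
    let L := linTerm as cs' h.choose.1 h.choose.2
    .ite (.le (.const 0) L) L (.const 0)
  else .star

/-! ## Over-approximation of loops -/

/-- Replace the value of `s` by `e` if this is more precise, i.e. `θ(s)` is unknown and `e` is
known. -/
def State.refine (θ : State) (s : Sym) (e : Term) : State :=
  if (θ s).hasStar && !e.hasStar then Function.update θ s e else θ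

/-- One pass of the main loop of `computeIteratedState`. -/
noncomputable def iterateRound (P : Program) (T : ExecTree) (cs : List Ctr) (θ : State) : State :=
  let θ₁ := P.vars.toList.foldl (fun θ a => θ.refine (.prog a)
    (T.iterateVariable cs (Function.update θ (.prog a) (State.general (.prog a))) a)) θ
  T.loops.foldl (fun θ γ => θ.refine (.art γ)
    (iterationsOfLoop P.vars cs
      (T.exitCond (P.exits (P.loopAt γ)) γ
        (Function.update θ (.art γ) (State.general (.art γ)))) γ)) θ₁

/-- `computeIteratedState`. Every pass that changes the state makes the value of at least one
more variable known, so the fixed point is reached after the given number of passes. -/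
noncomputable def iteratedState (P : Program) (T : ExecTree) (cs : List Ctr) : State :=
  (iterateRound P T cs)^[P.vars.card + T.loops.length + 1] State.unknown

/-- Restriction of an iterated state to the program variables. -/
def State.restrict (θ : State) (vars : Finset ℕ) : State
  | .prog a => if a ∈ vars then θ (.prog a) else .sym (.prog a)
  | .art γ => .sym (.art γ)

/-- `overapproximateLoop` for the loop of `P` at `α`. The first argument bounds the nesting depth
of loops; each induced program has fewer vertices than the program that contains the loop, so the
number of vertices is a sufficient bound. -/
noncomputable def overapproximateLoop : ℕ → Program → Path → Summary
  | 0, _, _ => ⟨[], [], State.general⟩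
  | n + 1, P, α =>
    let P' := P.induced (P.loopAt α) (lst α)
    let T := executeTree P' (overapproximateLoop n P')
    if T.leaves = [] then ⟨[], [], State.general⟩
    else
      let cs : List Ctr := (List.range T.leaves.length).map fun i => ⟨α, i⟩
      let θ := (iteratedState P' T cs).restrict P'.vars
      ⟨cs, T.leaves.map fun π => (T.pc π).applyState θ, θ⟩

/-- The necessary condition `φ̂` computed for the target location of `P`: the disjunction of the
path conditions of the remaining backbone paths. -/
noncomputable def necessaryCondition (P : Program) : Form :=
  let T := executeTree P (overapproximateLoop P.V.card P)
  SExpr.disj (T.leaves.map T.pc)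

end SymExec

namespace SymExec

/-! ## The witness: `x ← 1; while (0 < x) x ← x + x` -/

/-! The witness exploits that iterated values are only found when each backbone adds a constant
amount to a variable or overwrites it. Doubling does neither, so after the loop `x` is `⋆`, although
the invariant `0 < x`, established by `x ← 1` and preserved by doubling, makes leaving the loop
impossible.

The loss of information is located in `combine_doubling`: the value `x + x` fails all three tests of
the table. Since `refine` never stores a value containing `⋆`, the all-unknown state is already a
fixed point (`doublingBody_iterateRound`), and the summary of the loop maps `x` to `⋆`
(`doubling_overapproximateLoop`). Composition with the state before the loop does not help:
substituting `x = 1` into `⋆` gives `⋆`.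

Consequently the exit test on the only backbone `0, 1, 2, 5` becomes `¬ (0 < ⋆)`, the negation of a
fresh propositional variable. Make that variable false and choose the counter `κ = 0`: the looping
condition is then vacuous, whatever its body is, and the path condition is true for all inputs
(`eval_pcParts_loop`). The remaining work is to compute the paths and loops of two small graphs and
to run the algorithm on them. -/

/-- The program `x ← 1; while (0 < x) x ← x + x`, whose loop never terminates. -/
def doubling : Program where
  V := {0, 1, 2, 3, 4, 5}
  E := {(0, 1), (1, 2), (2, 3), (3, 4), (4, 2), (2, 5)}
  start := 0
  target := 5
  instr := fun e =>
    if e = (0, 1) then .assign 0 (.const 1)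
    else if e = (2, 3) then .assume (.pos (.lt (.const 0) (.var 0)))
    else if e = (3, 4) then .assign 0 (.add (.var 0) (.var 0))
    else if e = (2, 5) then .assume (.neg (.lt (.const 0) (.var 0)))
    else .skip
  vars := {0}

/-! ## Paths and loops -/

/-- Induction along the chain by transitivity. It is meant for cycles, `w = u`, where it yields `R u
u`. The hypothesis concerns only edges whose head lies in `ρ ++ [w]`, so that the vertices avoided
by a cycle can be used to verify it. -/
theorem chain_rel_ends {α : Type*} {E R : α → α → Prop} (hR : ∀ a b c, R a b → R b c → R a c)
    (w : α) : ∀ (ρ : List α) (u : α), (u :: (ρ ++ [w])).IsChain E →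
      (∀ a b, E a b → b ∈ ρ ++ [w] → R a b) → R u w
  | [], u, h, hE => hE u w (by simpa using h) (by simp)
  | v :: ρ, u, h, hE => by
    simp only [List.cons_append, List.isChain_cons_cons] at h
    exact hR u v w (hE u v h.1 (by simp))
      (chain_rel_ends hR w ρ v h.2 fun a b hab hb => hE a b hab (by simp_all))

namespace Program

theorem mem_loopAt {P : Program} {αv : Path} {x : ℕ} : x ∈ P.loopAt αv ↔ x ∈ P.V ∧
    ∃ ρ : Path, P.IsPath (lst αv :: (ρ ++ [lst αv])) ∧ (∀ y ∈ ρ, y ∉ αv) ∧ x ∈ lst αv :: ρ := by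
  classical exact Finset.mem_filter

theorem IsLoopEntry.exists_cycle {P : Program} {αv : Path} (h : P.IsLoopEntry αv) :
    ∃ ρ : Path, P.IsPath (lst αv :: (ρ ++ [lst αv])) ∧ ∀ y ∈ ρ, y ∉ αv := by
  obtain ⟨x, hx⟩ := h
  obtain ⟨-, ρ, h₁, h₂, -⟩ := mem_loopAt.1 hx
  exact ⟨ρ, h₁, h₂⟩

/-- A program whose edges increase the vertex has no loops. -/
theorem not_isLoopEntry_of_lt {P : Program} (hP : ∀ e ∈ P.E, e.1 < e.2) (αv : Path) :
    ¬ P.IsLoopEntry αv := by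
  intro h
  obtain ⟨ρ, h, -⟩ := h.exists_cycle
  exact lt_irrefl _ (chain_rel_ends (R := fun a b => a < b) (fun _ _ _ => lt_trans) _ ρ _ h.2
    fun a b hab _ => hP _ hab)

/-- With a single backbone, the unspecified order of `Finset.toList` plays no role and the algorithm
can be evaluated. -/
theorem backboneList_of_eq {P : Program} {π : Path} (h : P.backbones = {π}) :
    P.backboneList = [π] := by
  have : P.backbones_finite.toFinset = {π} := by
    ext x; simp [h]
  rw [backboneList, this, Finset.toList_singleton]

end Program

/-! ### Acyclic paths and the loop of the witness -/

theorem doubling_edge {u v : ℕ} : (u, v) ∈ doubling.E ↔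
    u = 0 ∧ v = 1 ∨ u = 1 ∧ v = 2 ∨ u = 2 ∧ v = 3 ∨ u = 3 ∧ v = 4 ∨ u = 4 ∧ v = 2 ∨
      u = 2 ∧ v = 5 := by
  simp [doubling]

/-- The only choice is at vertex 2. Continuing through 3 and 4 forces a return to 2, which `Nodup`
forbids, and 5 has no successor; so no case with six or more vertices survives. -/
theorem doubling_acyclic_path {π : Path} (h : doubling.IsPath π) (hd : π.Nodup)
    (hs : π.head? = some 0) :
    π ∈ [[0], [0, 1], [0, 1, 2], [0, 1, 2, 3], [0, 1, 2, 3, 4], [0, 1, 2, 5]] := by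
  obtain ⟨-, h⟩ := h
  rcases π with _ | ⟨a, _ | ⟨b, _ | ⟨c, _ | ⟨d, _ | ⟨e, _ | ⟨f, π⟩⟩⟩⟩⟩⟩ <;>
    simp only [List.isChain_cons_cons, doubling_edge, List.head?_cons, Option.some.injEq,
      List.nodup_cons, List.mem_cons, List.head?_nil, not_or] at h hd hs
  · cases hs
  all_goals
    simp only [List.mem_cons, List.cons.injEq, List.not_mem_nil, reduceCtorEq, and_false, and_true,
      or_false, false_or]
    omega

theorem doubling_isLoopEntry {π : Path} (h : doubling.IsPath π) (hd : π.Nodup)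
    (hs : π.head? = some 0) : doubling.IsLoopEntry π ↔ π = [0, 1, 2] := by
  constructor
  · intro hl
    obtain ⟨ρ, hρ, hn⟩ := hl.exists_cycle
    -- The only decreasing edge is `(4, 2)`, so each edge increases or ends at a vertex `≥ 2`, and
    -- this relation is transitive. On a cycle the first alternative is absurd.
    have h₁ : lst π < lst π ∨ 2 ≤ lst π :=
      chain_rel_ends (R := fun a b : ℕ => a < b ∨ 2 ≤ b) (by intros; omega) _ ρ _ hρ.2
        (by intro a b hab _; rw [doubling_edge] at hab; omega)
    -- If 2 lies on `π` but is not its end, the cycle may not enter 2. This rules out the edge `(4,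
    -- 2)`, and all other edges increase.
    have h₂ : 2 ∈ π → lst π ≠ 2 → False := fun h2 hne =>
      lt_irrefl _ <| chain_rel_ends (R := fun a b : ℕ => a < b) (by intros; omega) _ ρ _ hρ.2
        (by
          intro a b hab hb
          have : b ≠ 2 := by
            rintro rfl
            rcases List.mem_append.1 hb with hb | hb
            · exact hn _ hb h2
            · exact hne (List.mem_singleton.1 hb).symm
          rw [doubling_edge] at hab; omega)
    have := doubling_acyclic_path h hd hs
    simp only [List.mem_cons, List.not_mem_nil, or_false] at this
    rcases this with rfl | rfl | rfl | rfl | rfl | rfl <;> simp_all [lst]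
  · rintro rfl
    refine ⟨2, Program.mem_loopAt.2 ⟨by decide, [3, 4], ⟨by decide, ?_⟩, by decide, by decide⟩⟩
    simp [lst, doubling_edge]

theorem doubling_loopAt : doubling.loopAt [0, 1, 2] = {2, 3, 4} := by
  ext x
  rw [Program.mem_loopAt]
  constructor
  · rintro ⟨-, ρ, ⟨-, h⟩, hn, hx⟩
    rcases ρ with _ | ⟨a, _ | ⟨b, _ | ⟨c, ρ⟩⟩⟩ <;>
      simp [lst, doubling_edge] at h hn hx ⊢ <;> omega
  · intro hx
    refine ⟨?_, [3, 4], ⟨by decide, by simp [lst, doubling_edge]⟩, by decide, ?_⟩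
    · simp [doubling] at hx ⊢; omega
    · simpa [lst] using hx

theorem doubling_backbones : doubling.backbones = {[0, 1, 2, 5]} := by
  ext π
  constructor
  · rintro ⟨h, hd, hs, ht⟩
    have := doubling_acyclic_path h hd hs
    simp only [List.mem_cons, List.not_mem_nil, or_false] at this
    rcases this with rfl | rfl | rfl | rfl | rfl | rfl <;> simp_all [doubling]
  · rintro rfl
    exact ⟨⟨by decide, by simp [doubling_edge]⟩, by decide, rfl, rfl⟩

/-! ### The loop cut open at its entry -/

/-- The program induced by the loop of `doubling`. -/
def doublingBody : Program := doubling.induced {2, 3, 4} 2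

/-- The new target is `4 + 1 = 5`, which happens to be the number of the old target. The edge `(4,
5)` is the redirected back edge `(4, 2)`; the exit edge `(2, 5)` is discarded because 5 is outside
the loop. Now all edges increase, so no nested loop exists. -/
theorem doublingBody_E : doublingBody.E = {(2, 3), (3, 4), (4, 5)} := by decide

theorem doublingBody_edge {u v : ℕ} : (u, v) ∈ doublingBody.E ↔
    u = 2 ∧ v = 3 ∨ u = 3 ∧ v = 4 ∨ u = 4 ∧ v = 5 := by
  simp [doublingBody_E]

theorem doublingBody_not_isLoopEntry (π : Path) : ¬ doublingBody.IsLoopEntry π :=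
  Program.not_isLoopEntry_of_lt (by rw [doublingBody_E]; decide) π

theorem doublingBody_backbones : doublingBody.backbones = {[2, 3, 4, 5]} := by
  ext π
  constructor
  · rintro ⟨⟨-, h⟩, -, hs, ht⟩
    change _ = some 2 at hs
    change _ = some 5 at ht
    rcases π with _ | ⟨a, _ | ⟨b, _ | ⟨c, _ | ⟨d, _ | ⟨e, π⟩⟩⟩⟩⟩ <;>
      simp [List.isChain_cons_cons, doublingBody_edge] at h hs ht ⊢ <;> omega
  · rintro rfl
    exact ⟨⟨by decide, by simp [doublingBody_edge]⟩, by decide, rfl, rfl⟩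

/-! ## The witness is a normalized program with an unreachable target -/

theorem doubling_wellFormed : doubling.WellFormed where
  start_mem := by decide
  target_mem := by decide
  start_ne_target := by decide
  edge_mem := by decide
  connected := by
    have h : ∀ u ∈ doubling.V, Relation.EqvGen (fun x y => (x, y) ∈ doubling.E) 0 u := by
      have e : ∀ {a b c}, Relation.EqvGen (fun x y => (x, y) ∈ doubling.E) a b →
          (b, c) ∈ doubling.E → Relation.EqvGen (fun x y => (x, y) ∈ doubling.E) a c :=
        fun h h' => h.trans _ _ _ (.rel _ _ h')
      have h1 := e (.refl 0) (show (0, 1) ∈ doubling.E by decide)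
      have h2 := e h1 (show (1, 2) ∈ doubling.E by decide)
      have h3 := e h2 (show (2, 3) ∈ doubling.E by decide)
      have h4 := e h3 (show (3, 4) ∈ doubling.E by decide)
      have h5 := e h2 (show (2, 5) ∈ doubling.E by decide)
      intro u hu
      simp only [doubling, Finset.mem_insert, Finset.mem_singleton] at hu
      rcases hu with rfl | rfl | rfl | rfl | rfl | rfl
      exacts [.refl 0, h1, h2, h3, h4, h5]
    exact fun u hu v hv => ((h u hu).symm _ _).trans _ _ _ (h v hv)
  out_degree := by decide
  start_in := by decide
  target_out := by decide
  branching := by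
    intro u v w hvw hv hw
    rw [doubling_edge] at hv hw
    refine ⟨.lt (.const 0) (.var 0), ?_⟩
    have : u = 2 ∧ v = 3 ∧ w = 5 ∨ u = 2 ∧ v = 5 ∧ w = 3 := by omega
    rcases this with ⟨rfl, rfl, rfl⟩ | ⟨rfl, rfl, rfl⟩ <;> simp [doubling]
  vars_subset := by decide

theorem doubling_normalized : doubling.Normalized := by
  intro αv h hd hs hl u hu
  rw [(doubling_isLoopEntry h hd hs).1 hl] at hu ⊢
  change (u, 2) ∈ doubling.E at hu
  rw [doubling_edge] at hu
  have : u = 1 ∨ u = 4 := by omega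
  rcases this with rfl | rfl <;> simp [doubling, lst]

/-- From a vertex other than the start, `x` stays positive, and the target is not reached. -/
theorem doubling_not_follows : ∀ (π : Path) (u : ℕ) (σ : ℕ → ℤ), 0 < σ 0 → u ≠ 0 → u ≠ 5 →
    (u :: π).IsChain (fun u v => (u, v) ∈ doubling.E) → doubling.Follows (u :: π) σ →
    (u :: π).getLast? ≠ some 5
  | [], u, σ, _, _, h5, _, _ => by simpa using h5
  | v :: π, u, σ, hσ, h0, h5, hc, ⟨σ', hx, hf⟩ => by
    rw [List.isChain_cons_cons, doubling_edge] at hc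
    rw [List.getLast?_cons_cons]
    obtain ⟨he, hc⟩ := hc
    -- The invariant `0 < x` blocks the exit edge `(2, 5)` and survives doubling.
    have : v ≠ 5 ∧ 0 < σ' 0 ∧ v ≠ 0 := by
      rcases he with ⟨rfl, rfl⟩ | ⟨rfl, rfl⟩ | ⟨rfl, rfl⟩ | ⟨rfl, rfl⟩ | ⟨rfl, rfl⟩ | ⟨rfl, rfl⟩ <;>
        simp_all [doubling, Instr.Exec, Cond.Holds, Pred.Holds, AExp.eval]
    exact doubling_not_follows π v σ' this.2.1 this.2.2 this.1 hc hf

theorem doubling_not_targetReachable : ¬ doubling.TargetReachable := by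
  rintro ⟨π, ⟨-, hc⟩, hs, ht, σ, hf⟩
  change _ = some 0 at hs
  change _ = some 5 at ht
  rcases π with _ | ⟨a, _ | ⟨b, π⟩⟩
  · simp at hs
  · simp_all
  obtain ⟨σ', hx, hf⟩ := hf
  rw [List.isChain_cons_cons, doubling_edge] at hc
  obtain rfl : a = 0 := by simpa using hs
  obtain rfl : b = 1 := by omega
  -- The first edge is necessarily `(0, 1)`, which sets `x` to 1 for every input and so establishes
  -- the invariant.
  refine doubling_not_follows π 1 σ' ?_ (by decide) (by decide) hc.2 hf (by simpa using ht)
  simp only [doubling, if_true, Instr.Exec, AExp.eval] at hx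
  simp [hx]


/-! ## The iterated state of the loop -/

theorem doublingBody_instr₁ :
    doublingBody.instr (2, 3) = .assume (.pos (.lt (.const 0) (.var 0))) := rfl

theorem doublingBody_instr₂ :
    doublingBody.instr (3, 4) = .assign 0 (.add (.var 0) (.var 0)) := rfl

theorem doublingBody_instr₃ : doublingBody.instr (4, 5) = .skip := rfl

/-- `summ` is arbitrary because it is consulted only at loop entries, and there are none here. -/
theorem doublingBody_execPath (summ : Path → Summary) :
    execPath doublingBody summ [2, 3, 4, 5] =
      some ([.step .tt, .step (.lt (.const 0) (.sym (.prog 0))), .step .tt, .step .tt],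
        Function.update State.general (.prog 0) (.add (.sym (.prog 0)) (.sym (.prog 0)))) := by
  have h₁ : Form.Satisfiable (.imp (pcParts [.step .tt])
      (.lt (.const 0) (.sym (.prog 0)))) :=
    ⟨fun _ => True, fun _ => 1, fun _ => 0, by
      simp [Form.Holds, pcParts, SExpr.eval, SExpr.hasStar, SExpr.contains]⟩
  -- The input `x = 1` satisfies the path condition at each of the vertices 3, 4 and 5, so the
  -- backbone is never dropped.
  have h₂ : ∀ l ∈ [[], [Part.step .tt], [.step .tt, .step .tt]], Form.Satisfiable
      (pcParts ([.step .tt, .step (.lt (.const 0) (.sym (.prog 0)))] ++ l)) := fun l hl =>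
    ⟨fun _ => True, fun _ => 1, fun _ => 0, by
      simp only [List.mem_cons, List.not_mem_nil, or_false] at hl
      rcases hl with rfl | rfl | rfl <;>
        simp [Form.Holds, pcParts, SExpr.eval, SExpr.hasStar, SExpr.contains]⟩
  have h₂₀ := h₂ [] (by simp)
  have h₂₁ := h₂ [.step .tt] (by simp)
  have h₂₂ := h₂ [.step .tt, .step .tt] (by simp)
  simp only [List.append_nil, List.cons_append, List.nil_append] at h₂₀ h₂₁ h₂₂
  simp [execPath, execFrom, doublingBody_not_isLoopEntry, lst, doublingBody_instr₁,
    doublingBody_instr₂, doublingBody_instr₃, Instr.symb, Cond.symb, Pred.symb, AExp.symb,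
    State.general, h₁, h₂₀, h₂₁, h₂₂]

theorem doublingBody_leaves (summ : Path → Summary) :
    (executeTree doublingBody summ).leaves = [[2, 3, 4, 5]] := by
  simp [executeTree, Program.backboneList_of_eq doublingBody_backbones, doublingBody_execPath]

/-- Without loop entries, symbolic execution produces no looping conditions. -/
theorem execFrom_steps {P : Program} (hP : ∀ αv, ¬ P.IsLoopEntry αv) (summ : Path → Summary) :
    ∀ (π α : Path) (ps : List Part) (θ : State), (∀ p ∈ ps, ∃ φ, p = .step φ) →
      ∀ x, execFrom P summ π α ps θ = some x → ∀ p ∈ x.1, ∃ φ, p = .step φ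
  | [], _, ps, θ, hps, x, hx => by
    obtain rfl : (ps, θ) = x := by simpa [execFrom] using hx
    exact hps
  | v :: π, α, ps, θ, hps, x, hx => by
    rw [execFrom, if_neg (hP _)] at hx
    dsimp only at hx
    split_ifs at hx
    refine execFrom_steps hP summ π _ _ _ ?_ x hx
    intro p hp
    rcases List.mem_append.1 hp with hp | hp
    · exact hps p hp
    · exact ⟨_, List.mem_singleton.1 hp⟩

/-- This makes `loops` and every `loopsIn` empty, so that `barTheta` agrees with `Theta` and no
artificial symbols have to be treated. The default values for removed or empty paths are steps as
well. -/
theorem executeTree_Psi_step {P : Program} (hP : ∀ αv, ¬ P.IsLoopEntry αv)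
    (summ : Path → Summary) (δ : Path) : ∃ φ, (executeTree P summ).Psi δ = .step φ := by
  simp only [executeTree]
  cases h : execPath P summ δ with
  | none => exact ⟨_, rfl⟩
  | some x =>
    rcases δ with _ | ⟨u, π⟩
    · simp [execPath] at h
    · have hx := execFrom_steps hP summ π [u] [.step .tt] _ (by simp) x h
      rcases List.eq_nil_or_concat x.1 with hn | ⟨l, p, hl⟩
      · exact ⟨.tt, by simp [hn]⟩
      · obtain ⟨φ, rfl⟩ := hx p (by simp [hl])
        exact ⟨φ, by simp [hl]⟩

theorem ExecTree.loops_eq_nil {T : ExecTree} (hT : ∀ δ, ∃ φ, T.Psi δ = .step φ) :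
    T.loops = [] := by
  refine List.filter_eq_nil_iff.2 fun γ _ => ?_
  obtain ⟨φ, h⟩ := hT γ
  simp [h]

theorem ExecTree.loopsIn_eq_nil {T : ExecTree} (hT : ∀ δ, ∃ φ, T.Psi δ = .step φ)
    (l : List Path) : T.loopsIn l = [] := by
  refine List.filterMap_eq_nil_iff.2 fun γ _ => ?_
  obtain ⟨φ, h⟩ := hT γ
  simp [h]

/-- The candidate increment `d` and the candidate value `ρ` both arise by putting 0 for `x`, so both
are `0 + 0`. The tests therefore compare `x + x` with `x`, with `x + (0 + 0)` and with `0 + 0`; all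
three fail at `x = 1`. -/
theorem combine_doubling (c : Ctr) (π : Path) : combine 0 [c] .same (c, π)
    (.add (.sym (.prog 0)) (.sym (.prog 0))) = .unknown := by
  have key : ∀ u : Term, (∀ x : ℤ, (u.eval (fun _ => True) (fun _ => x) (fun _ => 0) [] [] : ℤ)
      = x ∨ (u.eval (fun _ => True) (fun _ => x) (fun _ => 0) [] [] : ℤ) = 0) →
      ¬ Term.Equal (.add (.sym (.prog 0)) (.sym (.prog 0))) u := by
    rintro u hu ⟨-, -, h⟩
    have h₁ := h (fun _ => True) (fun _ => 1) (fun _ => 0) [] []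
    rcases hu 1 with h' | h' <;> rw [h'] at h₁ <;> simp [SExpr.eval] at h₁
  unfold combine
  rw [if_neg, if_neg, if_neg]
  all_goals
    apply key
    simp [SExpr.eval, SExpr.subst, SExpr.substCtrs]

theorem doublingBody_iterateRound (summ : Path → Summary) (c : Ctr) :
    iterateRound doublingBody (executeTree doublingBody summ) [c] State.unknown =
      State.unknown := by
  have hT := executeTree_Psi_step doublingBody_not_isLoopEntry summ
  have hv : doublingBody.vars.toList = [0] := Finset.toList_singleton 0
  have hΘ : (executeTree doublingBody summ).Theta [2, 3, 4, 5] (.prog 0) =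
      .add (.sym (.prog 0)) (.sym (.prog 0)) := by
    simp [executeTree, doublingBody_execPath]
  simp only [iterateRound, hv, ExecTree.loops_eq_nil hT, List.foldl_cons, List.foldl_nil,
    ExecTree.iterateVariable, doublingBody_leaves, List.zip_cons_cons, List.zip_nil_right,
    ExecTree.barTheta, ExecTree.loopsIn_eq_nil hT, hΘ]
  -- While `x` is being iterated, its unknown value is replaced by its own symbol, so `x + x`
  -- reaches the table without any `⋆`.
  have : (SExpr.add (.sym (.prog 0)) (.sym (.prog 0))).applyState
      (Function.update State.unknown (.prog 0) (State.general (.prog 0))) =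
      .add (.sym (.prog 0)) (.sym (.prog 0)) := by
    simp [SExpr.applyState, SExpr.subst, State.general]
  rw [this, combine_doubling]
  simp [Shape.term, State.refine, SExpr.hasStar, SExpr.contains]

/-- The loop of `doubling` is summarized with one counter, and the value of `x` is unknown. -/
theorem doubling_overapproximateLoop : ∃ (c : Ctr) (ψ : Form),
    (overapproximateLoop doubling.V.card doubling [0, 1, 2]).cs = [c] ∧
    (overapproximateLoop doubling.V.card doubling [0, 1, 2]).bodies = [ψ] ∧
    (overapproximateLoop doubling.V.card doubling [0, 1, 2]).state (.prog 0) = .star := by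
  -- A positive depth bound allows one unfolding. The recursive summary of `doublingBody` that
  -- appears is irrelevant, since the lemmas about that program hold for every `summ`.
  have hc : doubling.V.card = 5 + 1 := rfl
  have hP : doubling.induced (doubling.loopAt [0, 1, 2]) (lst [0, 1, 2]) = doublingBody := by
    rw [doubling_loopAt]; rfl
  have hr : [(⟨[0, 1, 2], 0⟩ : Ctr)] = (List.range 1).map fun i => ⟨[0, 1, 2], i⟩ := rfl
  rw [hc, overapproximateLoop]
  simp only [hP, doublingBody_leaves, List.cons_ne_nil, if_false, List.length_singleton]
  rw [← hr]
  refine ⟨_, _, rfl, rfl, ?_⟩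
  -- The starting state is itself a fixed point, so the number of passes does not matter.
  rw [iteratedState, Function.iterate_fixed (doublingBody_iterateRound _ _)]
  have hv : 0 ∈ doublingBody.vars := by decide
  simp [State.restrict, hv, State.unknown]

/-! ## The condition computed for the target -/

/-- If the fresh propositional variables are false, then no iteration of the loop is needed before
it is left by an unknown negated predicate. -/
theorem eval_pcParts_loop (c : Ctr) (ψ : Form) (ν : Sym → ℤ) (μ : LVar → ℕ) (p : List ℕ) :
    ((pcParts [.step .tt, .step .tt, .loop [c] [ψ], .step (.not (.lt (.const 0) .star))]).eval
      (fun _ => False) ν μ [] p : Prop) := by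
  simp [pcParts, SExpr.eval, SExpr.exs, SExpr.alls, SExpr.close, SExpr.conj, vecLe, loopCond,
    SExpr.hasStar, SExpr.contains, Ctr.kap, Ctr.par]
  -- With `κ = 0` no `τ` satisfies `0 ≤ τ < κ`, so the body `ψ` is never required to hold.
  exact ⟨0, by simp⟩

theorem doubling_instr : doubling.instr (0, 1) = .assign 0 (.const 1) ∧
    doubling.instr (2, 5) = .assume (.neg (.lt (.const 0) (.var 0))) := ⟨rfl, rfl⟩

/-- `ExecTree.pc` reassembles a path condition from the values of `Psi` at all prefixes, which is
why each prefix of the backbone is executed. The body `ψ'` and the states may stay unspecified: the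
final condition is true regardless of them. -/
theorem doubling_execPath {summ : Path → Summary} {c : Ctr} {ψ : Form}
    (hcs : (summ [0, 1, 2]).cs = [c]) (hb : (summ [0, 1, 2]).bodies = [ψ])
    (hs : (summ [0, 1, 2]).state (.prog 0) = .star) : ∃ ψ' θ θ' θ'',
    execPath doubling summ [0] = some ([.step .tt], State.general) ∧
    execPath doubling summ [0, 1] = some ([.step .tt, .step .tt], θ) ∧
    execPath doubling summ [0, 1, 2] = some ([.step .tt, .step .tt, .loop [c] [ψ']], θ') ∧
    execPath doubling summ [0, 1, 2, 5] = some ([.step .tt, .step .tt, .loop [c] [ψ'],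
      .step (.not (.lt (.const 0) .star))], θ'') := by
  have e : ∀ {π : Path}, π ∈ [[0, 1], [0, 1, 2], [0, 1, 2, 5]] →
      (doubling.IsLoopEntry π ↔ π = [0, 1, 2]) := by
    intro π hπ
    simp only [List.mem_cons, List.not_mem_nil, or_false] at hπ
    rcases hπ with rfl | rfl | rfl <;>
      exact doubling_isLoopEntry ⟨by decide, by simp [doubling_edge]⟩ (by decide) rfl
  have e₁ : ¬ doubling.IsLoopEntry [0, 1] := by rw [e (by simp)]; simp
  have e₂ : doubling.IsLoopEntry [0, 1, 2] := by rw [e (by simp)]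
  have e₃ : ¬ doubling.IsLoopEntry [0, 1, 2, 5] := by rw [e (by simp)]; simp
  have s₁ : Form.Satisfiable (pcParts [.step .tt, .step .tt]) :=
    ⟨fun _ => True, fun _ => 0, fun _ => 0, by simp [Form.Holds, pcParts, SExpr.eval]⟩
  -- Interpreting the fresh variable as false already makes the conclusion of the implication true.
  have s₂ : ∀ ψ, Form.Satisfiable (.imp (pcParts [.step .tt, .step .tt, .loop [c] [ψ]])
      (.not (.lt (.const 0) .star))) := fun ψ =>
    ⟨fun _ => False, fun _ => 0, fun _ => 0, by
      simp [Form.Holds, SExpr.eval, SExpr.hasStar, SExpr.contains]⟩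
  have s₃ : ∀ ψ, Form.Satisfiable (pcParts [.step .tt, .step .tt, .loop [c] [ψ],
      .step (.not (.lt (.const 0) .star))]) := fun ψ =>
    ⟨_, fun _ => 0, fun _ => 0, eval_pcParts_loop c ψ _ _ _⟩
  -- The state after `x ← 1`. Merging it into the summary leaves `⋆` as the value of `x`, because
  -- substitution does not affect `⋆`.
  let θ : State := Function.update State.general (.prog 0) (.const 1)
  refine ⟨ψ.applyState θ, θ, (summ [0, 1, 2]).state.merge θ, (summ [0, 1, 2]).state.merge θ, rfl,
    ?_, ?_, ?_⟩ <;>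
  simp [execPath, execFrom, e₁, e₂, e₃, lst, doubling_instr, Instr.symb, Cond.symb, Pred.symb,
    AExp.symb, s₁, s₂, s₃, hcs, hb, hs, State.merge, SExpr.applyState, SExpr.subst, θ]

theorem doubling_necessaryCondition : ∃ c ψ, necessaryCondition doubling =
    .or (pcParts [.step .tt, .step .tt, .loop [c] [ψ], .step (.not (.lt (.const 0) .star))])
      .ff := by
  obtain ⟨c, ψ, hcs, hb, hs⟩ := doubling_overapproximateLoop
  obtain ⟨ψ', θ, θ', θ'', h₁, h₂, h₃, h₄⟩ := doubling_execPath hcs hb hs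
  refine ⟨c, ψ', ?_⟩
  simp [necessaryCondition, executeTree, Program.backboneList_of_eq doubling_backbones,
    ExecTree.pc, prefixes, SExpr.disj, h₁, h₂, h₃, h₄]

theorem doubling_holds (ν : Sym → ℤ) (μ : LVar → ℕ) :
    (necessaryCondition doubling).Holds (fun _ => False) ν μ := by
  obtain ⟨c, ψ, h⟩ := doubling_necessaryCondition
  rw [h]
  exact Or.inl (eval_pcParts_loop c ψ ν μ _)

end SymExec

theorem mainTheorem2 :
    ∃ P : SymExec.Program, P.WellFormed ∧ P.Normalized ∧ ¬ P.TargetReachable ∧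
      (SymExec.necessaryCondition P).Satisfiable ∧
      ∃ I : List ℕ → Prop, ∀ ν μ, (SymExec.necessaryCondition P).Holds I ν μ :=
  ⟨SymExec.doubling, SymExec.doubling_wellFormed, SymExec.doubling_normalized,
    SymExec.doubling_not_targetReachable, ⟨_, fun _ => 0, fun _ => 0, SymExec.doubling_holds _ _⟩,
    _, SymExec.doubling_holds⟩
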